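/- Let $s\ge 3$, $m\ge 0$, $\lambda_s\in\mathbb C$, and consider the scalar $\phi^s$-theory $$\mathcal L_\phi=\tfrac12\,\partial_\mu\phi\,\partial^\mu\phi-\tfrac12 m^2\phi^2-\tfrac{\lambda_s}{s!}\phi^s .$$ Let $a_0=1$ and $a_1,a_2,\ldots\in\mathbb C$, and let $\mathcal L_\rho$ be the Lagrangian obtained from $\mathcal L_\phi$ by inserting the formal field diffeomorphism $\phi=\sum_{j\ge0}a_j\rho^{j+1}$, i.e. $$\mathcal L_\rho=\tfrac12\,\phi'(\rho)^2\,\partial_\mu\rho\,\partial^\mu\rho-\tfrac12 m^2\phi(\rho)^2-\tfrac{\lambda_s}{s!}\phi(\rho)^s .$$ For a (complex) momentum $p$ in Minkowski space of any dimension put $x_p=p^2-m^2$. Both theories have the propagator $i/x_p$. The vertices of $\phi^s$-theory are the $s$-valent vertices $-i\lambda_s$. The $k$-valent vertices of the $\rho$-theory ($k\ge3$) with incoming momenta $p_1,\ldots,p_k$, $\sum_j p_j=0$, are $$i f_k\,(x_{p_1}+\cdots+x_{p_k})+i\,(k f_k-c_k)\,m^2-i w_k,$$ $$f_k=\tfrac{(k-2)!}{2}[\rho^{k-2}]\,\phi'(\rho)^2,\qquad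 c_k=\tfrac{k!}{2}[\rho^k]\,\phi(\rho)^2,\qquad w_k=k!\,\tfrac{\lambda_s}{s!}[\rho^k]\,\phi(\rho)^s .$$ Let $n\ge 3$ and let $p_1,\ldots,p_n$ be incoming external momenta with $\sum_j p_j=0$, all of them onshell ($x_{p_j}=0$ for all $j$), and such that no internal propagator is singular: $x_{p_S}\neq0$, where $p_S=\sum_{j\in S}p_j$, for every $S\subseteq\{1,\ldots,n\}$ with $2\le|S|\le n-2$. The tree-level amplitude of a theory is the sum, over all trees with $n$ labelled external edges and internal vertices of valence at least $3$, of the product of the Feynman rules of the vertices and of the propagators of the internal edges (external edges are amputated). Then the tree-level amplitude ${A'}^0_n$ of the $\rho$-theory equals the tree-level amplitude of the original $\phi^s$-theory at $p_1,\ldots,p_n$. Thus the diffeomorphism does not alter the onshell tree-level Feynman amplitudes, i.e. the tree-level $S$-matrix. -/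

import Mathlib

open PowerSeries

noncomputable section

namespace FieldDiffeo

/-! ### Kinematics -/

/-- Energy-momentum vectors of a spacetime with `d` space dimensions (`d = 3` is the physical
case). Complex components are allowed, as usual for scattering amplitudes; real momenta are a
special case. All external momenta are counted as incoming. -/
abbrev Momentum (d : ℕ) : Type := Fin (d + 1) → ℂ

/-- The Minkowski product `p · q = p⁰q⁰ - p¹q¹ - ⋯ - pᵈqᵈ`. -/
def mdot {d : ℕ} (p q : Momentum d) : ℂ := p 0 * q 0 - ∑ j : Fin d, p j.succ * q j.succ

/-- The offshell variable `x_p = p² - m²`. A momentum `p` is onshell when it vanishes. -/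
def offshell {d : ℕ} (m : ℝ) (p : Momentum d) : ℂ := mdot p p - (m : ℂ) ^ 2

/-! ### Lagrangians and diffeomorphisms of the field -/

/-- The Lagrangian density `½ K(φ) ∂_μφ ∂^μφ - U(φ)` of one scalar field `φ`, with formal power
series `K = kin` and `U = pot`. -/
structure Lagrangian where
  kin : ℂ⟦X⟧
  pot : ℂ⟦X⟧

/-- `φ^s`-theory: `½ ∂_μφ ∂^μφ - ½ m² φ² - (λ/s!) φ^s`. -/
def phiTheory (m : ℝ) (s : ℕ) (lam : ℂ) : Lagrangian where
  kin := 1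
  pot := C ((m : ℂ) ^ 2 / 2) * X ^ 2 + C (lam / (s.factorial : ℂ)) * X ^ s

/-- The power series `φ(ρ) = ∑_{j ≥ 0} a_j ρ^{j+1}`. -/
def diffeo (a : ℕ → ℂ) : ℂ⟦X⟧ := X * PowerSeries.mk a

/-- The Lagrangian of `ρ` obtained by inserting `φ = φ(ρ)`. Since `∂_μ φ(ρ) = φ'(ρ) ∂_μ ρ`, it is
`½ K(φ(ρ)) φ'(ρ)² ∂_μρ ∂^μρ - U(φ(ρ))`. -/
def Lagrangian.pullback (L : Lagrangian) (φ : ℂ⟦X⟧) : Lagrangian where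
  kin := L.kin.subst φ * (derivative ℂ φ) ^ 2
  pot := L.pot.subst φ

/-! ### Feynman rules -/

/-- The Feynman rule of the vertex whose legs are indexed by `κ` and carry the incoming momenta
`q`. With `k` the number of legs, the monomial `½ K_{k-2} φ^{k-2} ∂_μφ ∂^μφ - U_k φ^k` of the
Lagrangian gives `i` times the sum over all assignments of the legs to the `k` factors `φ`,
where each derivative `∂_μ` contributes `-i q_μ` of its leg. -/
def Lagrangian.vertex (L : Lagrangian) {d : ℕ} {κ : Type} [Fintype κ] [DecidableEq κ]
    (q : κ → Momentum d) : ℂ :=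
  Complex.I *
    (-(1 / 2 * ((Fintype.card κ - 2).factorial : ℂ) * coeff (Fintype.card κ - 2) L.kin *
        ∑ e ∈ (Finset.univ : Finset κ).offDiag, mdot (q e.1) (q e.2))
      - ((Fintype.card κ).factorial : ℂ) * coeff (Fintype.card κ) L.pot)

/-- The propagator, determined by the quadratic part `½ K₀ ∂_μφ ∂^μφ - U₂ φ²` of the
Lagrangian: `i / (K₀ p² - 2 U₂)`. -/
def Lagrangian.propagator (L : Lagrangian) {d : ℕ} (p : Momentum d) : ℂ :=
  Complex.I / (coeff 0 L.kin * mdot p p - 2 * coeff 2 L.pot)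

/-! ### Trees -/

/-- The part of a Feynman tree which hangs below one of its edges and contains exactly the
external edges in `S`: either the edge is itself the external edge `i`, and `S = {i}`, or its
lower end is a vertex. The further edges at that vertex (at least two, so that the valence is at
least three) are not ordered, and are given by a partition of `S` into the sets of external edges
which lie below them. -/
inductive FeynTree {ι : Type} [DecidableEq ι] : Finset ι → Type
  | leaf {S : Finset ι} (i : ι) (h : S = {i}) : FeynTree S
  | node {S : Finset ι} (P : Finpartition S) (h : 2 ≤ P.parts.card)
      (c : ∀ B : {B // B ∈ P.parts}, FeynTree B.1) : FeynTree S

section Trees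

variable {ι : Type} [DecidableEq ι]

theorem FeynTree.finite (S : Finset ι) : Finite (FeynTree S) := by
  induction S using Finset.strongInduction with
  | H S ih =>
    have hfin : ∀ P : {P : Finpartition S // 2 ≤ P.parts.card},
        Finite (∀ B : {B // B ∈ P.1.parts}, FeynTree B.1) := by
      intro P
      have : ∀ B : {B // B ∈ P.1.parts}, Finite (FeynTree B.1) := by
        intro B
        apply ih
        refine lt_of_le_of_ne (P.1.le B.2) ?_
        intro hB
        obtain ⟨B', hB', hne⟩ := Finset.exists_mem_ne
          (lt_of_lt_of_le Nat.one_lt_two P.2) B.1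
        have hd := P.1.disjoint hB' B.2 hne
        have hle := P.1.le hB'
        rw [← hB] at hle
        exact P.1.ne_bot hB' (disjoint_self.mp (hd.mono_right hle))
      exact Pi.finite
    have : Finite {P : Finpartition S // 2 ≤ P.parts.card} := inferInstance
    let f : FeynTree S → S ⊕ (Σ P : {P : Finpartition S // 2 ≤ P.parts.card},
        ∀ B : {B // B ∈ P.1.parts}, FeynTree B.1) := fun t => match t with
      | .leaf i h => Sum.inl ⟨i, by simp [h]⟩
      | .node P h c => Sum.inr ⟨⟨P, h⟩, c⟩
    refine Finite.of_injective f ?_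
    intro t t' htt
    cases t with
    | leaf i h =>
      cases t' with
      | leaf j h' => simp only [f, Sum.inl.injEq, Subtype.mk.injEq] at htt; subst htt; rfl
      | node P h' c => simp [f] at htt
    | node P h c =>
      cases t' with
      | leaf j h' => simp [f] at htt
      | node P' h' c' =>
        simp only [f, Sum.inr.injEq, Sigma.mk.injEq, Subtype.mk.injEq] at htt
        obtain ⟨rfl, hc⟩ := htt
        cases hc
        rfl

instance (S : Finset ι) : Fintype (FeynTree S) :=
  haveI := FeynTree.finite S
  Fintype.ofFinite _

/-- The momentum which the external edges in `S` carry into the tree. -/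
def inflow {d : ℕ} (p : ι → Momentum d) (S : Finset ι) : Momentum d := ∑ i ∈ S, p i

/-- The momenta flowing into the uppermost vertex of a tree with external edges `S`: `inflow p B`
from the edge above the part `B`, and `-inflow p S` from the upper edge `none`. -/
def legMomentum {d : ℕ} (p : ι → Momentum d) {S : Finset ι} (P : Finpartition S) :
    Option {B // B ∈ P.parts} → Momentum d
  | none => -inflow p S
  | some B => inflow p B.1

/-- The factor of the edge above a tree: the propagator if this edge ends in a vertex, and `1` if
it is an external edge, because external edges are amputated. -/
def FeynTree.edgeFactor (L : Lagrangian) {d : ℕ} (p : ι → Momentum d) :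
    {S : Finset ι} → FeynTree S → ℂ
  | _, .leaf _ _ => 1
  | S, .node _ _ _ => L.propagator (inflow p S)

/-- The Feynman amplitude of a tree, the product of its vertices and of the propagators of its
edges. The uppermost edge is not included. -/
def FeynTree.amplitude (L : Lagrangian) {d : ℕ} (p : ι → Momentum d) :
    {S : Finset ι} → FeynTree S → ℂ
  | _, .leaf _ _ => 1
  | _, .node P _ c =>
      L.vertex (legMomentum p P) * ∏ B, ((c B).edgeFactor L p * (c B).amplitude L p)

/-- The sum of all trees whose external edges are labelled by `ι` and carry the incoming momenta
`p`, all of them amputated. Each tree is drawn in exactly one way with the external edge `r` on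
top, so that the other external edges lie below the vertex at which `r` is attached. -/
def treeSum [Fintype ι] (L : Lagrangian) {d : ℕ} (p : ι → Momentum d) (r : ι) : ℂ :=
  ∑ t : FeynTree (Finset.univ.erase r), t.amplitude L p

end Trees

/-! ### The Feynman rules in explicit form -/

theorem hasSubst_diffeo (a : ℕ → ℂ) : HasSubst (diffeo a) :=
  HasSubst.of_constantCoeff_zero' (by simp [diffeo])

theorem pullback_phiTheory_kin (m : ℝ) (s : ℕ) (lam : ℂ) (a : ℕ → ℂ) :
    ((phiTheory m s lam).pullback (diffeo a)).kin = (derivative ℂ (diffeo a)) ^ 2 := by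
  have h : (1 : ℂ⟦X⟧).subst (diffeo a) = (1 : ℂ⟦X⟧) := by
    rw [← coe_substAlgHom (hasSubst_diffeo a), map_one]
  simp [Lagrangian.pullback, phiTheory, h]

theorem pullback_phiTheory_pot (m : ℝ) (s : ℕ) (lam : ℂ) (a : ℕ → ℂ) :
    ((phiTheory m s lam).pullback (diffeo a)).pot =
      C ((m : ℂ) ^ 2 / 2) * diffeo a ^ 2 + C (lam / (s.factorial : ℂ)) * diffeo a ^ s := by
  have hs := hasSubst_diffeo a
  simp only [Lagrangian.pullback, phiTheory]
  rw [subst_add hs, subst_mul hs, subst_mul hs, subst_pow hs, subst_pow hs, subst_X hs]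
  rw [subst_C, subst_C]
  rfl

/-- The coefficients `f_n`, `c_{n-2}`, `g_n = n f_n - c_{n-2}`, `w_n` of the Lagrangian of `ρ`. -/
def fCoeff (a : ℕ → ℂ) (n : ℕ) : ℂ :=
  ((n - 2).factorial : ℂ) / 2 * coeff (n - 2) ((derivative ℂ (diffeo a)) ^ 2)

def cCoeff (a : ℕ → ℂ) (n : ℕ) : ℂ := (n.factorial : ℂ) / 2 * coeff n (diffeo a ^ 2)

def gCoeff (a : ℕ → ℂ) (n : ℕ) : ℂ := n * fCoeff a n - cCoeff a n

def wCoeff (a : ℕ → ℂ) (s : ℕ) (lam : ℂ) (n : ℕ) : ℂ :=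
  (n.factorial : ℂ) * (lam / (s.factorial : ℂ)) * coeff n (diffeo a ^ s)

theorem sum_offDiag_mdot {d : ℕ} {κ : Type} [Fintype κ] [DecidableEq κ] (q : κ → Momentum d)
    (hq : ∑ i, q i = 0) :
    ∑ e ∈ (Finset.univ : Finset κ).offDiag, mdot (q e.1) (q e.2) = -∑ i, mdot (q i) (q i) := by
  have h0 : ∀ j, ∑ i, q i j = 0 := fun j => by
    have := congrFun hq j
    simpa [Finset.sum_apply] using this
  have hall : ∑ i, ∑ k, mdot (q i) (q k) = 0 := by
    have hk : ∀ i, ∑ k, mdot (q i) (q k) = 0 := by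
      intro i
      simp only [mdot, Finset.sum_sub_distrib, ← Finset.mul_sum, h0]
      rw [Finset.sum_comm]
      simp [← Finset.mul_sum, h0]
    simp [hk]
  have hsplit := Finset.sum_union (f := fun e : κ × κ => mdot (q e.1) (q e.2))
    (Finset.disjoint_diag_offDiag (Finset.univ : Finset κ))
  rw [Finset.diag_union_offDiag, Finset.sum_product, hall] at hsplit
  rw [Finset.sum_diag] at hsplit
  linear_combination -hsplit

/-- The vertices of the transformed theory, `i f_n (x₁ + ⋯ + x_n) + i g_n m² - i w_n`. -/
theorem vertex_pullback (m : ℝ) (s : ℕ) (lam : ℂ) (a : ℕ → ℂ) {d : ℕ} {κ : Type} [Fintype κ]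
    [DecidableEq κ] (q : κ → Momentum d) (hq : ∑ i, q i = 0) :
    ((phiTheory m s lam).pullback (diffeo a)).vertex q =
      Complex.I * fCoeff a (Fintype.card κ) * ∑ i, offshell m (q i)
        + Complex.I * gCoeff a (Fintype.card κ) * (m : ℂ) ^ 2
        - Complex.I * wCoeff a s lam (Fintype.card κ) := by
  rw [Lagrangian.vertex, sum_offDiag_mdot q hq, pullback_phiTheory_kin, pullback_phiTheory_pot]
  simp only [offshell, Finset.sum_sub_distrib, Finset.sum_const, Finset.card_univ, nsmul_eq_mul,
    gCoeff, fCoeff, cCoeff, wCoeff, map_add, coeff_C_mul]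
  ring

/-- The vertices of `φ^s`-theory: only the `s`-valent vertex `-iλ`. -/
theorem vertex_phiTheory (m : ℝ) (s : ℕ) (lam : ℂ) {d : ℕ} {κ : Type} [Fintype κ]
    [DecidableEq κ] (q : κ → Momentum d) (hk : 3 ≤ Fintype.card κ) :
    (phiTheory m s lam).vertex q = if Fintype.card κ = s then -Complex.I * lam else 0 := by
  have h1 : Fintype.card κ - 2 ≠ 0 := by omega
  have h2 : Fintype.card κ ≠ 2 := by omega
  have hf : (s.factorial : ℂ) ≠ 0 := by exact_mod_cast s.factorial_ne_zero
  simp only [Lagrangian.vertex, phiTheory, coeff_one, h1, if_false, map_add, coeff_C_mul,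
    coeff_X_pow, h2]
  split_ifs with h
  · rw [h]; field_simp; ring
  · simp

theorem propagator_phiTheory (m : ℝ) (s : ℕ) (hs : 3 ≤ s) (lam : ℂ) {d : ℕ} (p : Momentum d) :
    (phiTheory m s lam).propagator p = Complex.I / offshell m p := by
  have h : (2 : ℕ) ≠ s := by omega
  simp [Lagrangian.propagator, phiTheory, offshell, coeff_C_mul, coeff_X_pow, h]
  congr 1
  ring

theorem propagator_pullback (m : ℝ) (s : ℕ) (hs : 3 ≤ s) (lam : ℂ) (a : ℕ → ℂ) (ha : a 0 = 1)
    {d : ℕ} (p : Momentum d) :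
    ((phiTheory m s lam).pullback (diffeo a)).propagator p = Complex.I / offshell m p := by
  have hk : coeff 0 ((derivative ℂ (diffeo a)) ^ 2) = 1 := by
    have h : coeff 0 (derivative ℂ (diffeo a)) = 1 := by
      rw [coeff_derivative, diffeo, coeff_succ_X_mul]
      simp [ha]
    rw [coeff_zero_eq_constantCoeff_apply] at h ⊢
    rw [map_pow, h, one_pow]
  have h2 : coeff 2 (diffeo a ^ 2) = 1 := by
    rw [diffeo, mul_pow, coeff_X_pow_mul', if_pos le_rfl]
    simp [ha]
  have h3 : coeff 2 (diffeo a ^ s) = 0 := by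
    rw [diffeo, mul_pow, coeff_X_pow_mul', if_neg (by omega)]
  rw [Lagrangian.propagator, pullback_phiTheory_kin, pullback_phiTheory_pot, hk]
  simp only [map_add, coeff_C_mul, h2, h3, offshell]
  congr 1
  ring

end FieldDiffeo

end

/-! The proof is the covariance of classical field equations, read off tree sums. Each external edge
`i` gets a formal variable `x_i`, and the sums of trees below an edge (`current`) become the
coefficients of a polynomial in squarefree monomials. A product of such polynomials, read at a
squarefree monomial, sums over partitions of its index set (`coeff_genPoly_pow`), exactly as the
legs below a vertex do. With momenta acting as derivations, the coefficient of the field equation at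
`S` is therefore the sum over all uppermost vertices, including a two-valent one, the inverse
propagator (`coeff_fieldEq_genPoly`).

So the currents solve the field equation at every nonempty proper subset of `T`, the set of all
edges but `r`. At `T` the inverse propagator vanishes, because `r` is onshell, and what remains is
the amplitude (`coeff_fieldEq_current`).

Inserting `φ = Φ(ρ)` multiplies the field equation by `Φ'(ρ)`, whose constant term is 1
(`fieldEq_comp`). Hence `Φ` of the `ρ`-currents solves the `φ^s`-equation below `T` with the same
linear terms, and by recursion it agrees there with the `φ`-currents. At `T` the only new unknown is
multiplied by `x_{p_T} = 0`, so both obstructions, and thus both amplitudes, coincide. -/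

noncomputable section

namespace FieldDiffeo

/-! ### Partitions with a marked part -/

section Partitions

variable {ι : Type} [DecidableEq ι]

/-- Marking one part of a partition amounts to choosing this part and partitioning the rest. -/
theorem sum_finpartition_sum_parts {R : Type*} [CommSemiring R] (S : Finset ι)
    (F : Finset ι → Finset (Finset ι) → R) :
    ∑ P : Finpartition S, ∑ B ∈ P.parts, F B (P.parts.erase B) =
      ∑ B ∈ S.powerset.erase ∅, ∑ P : Finpartition (S \ B), F B P.parts := by
  rw [Finset.sum_sigma', Finset.sum_sigma']
  symm
  have hne : ∀ x : (Σ B : Finset ι, Finpartition (S \ B)),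
      x ∈ (S.powerset.erase ∅).sigma (fun B => (Finset.univ : Finset (Finpartition (S \ B)))) →
      x.1 ≠ ⊥ ∧ (S \ x.1) ⊔ x.1 = S := by
    intro x hx
    simp only [Finset.mem_sigma, Finset.mem_erase, Finset.mem_powerset] at hx
    exact ⟨hx.1.1, Finset.sdiff_union_of_subset hx.1.2⟩
  have hnot : ∀ B : Finset ι, B ≠ ⊥ → ∀ P : Finpartition (S \ B), B ∉ P.parts := by
    intro B hB P hBP
    exact hB (disjoint_self.mp (Finset.sdiff_disjoint.mono_left (P.le hBP)))
  refine Finset.sum_bij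
    (fun x hx => ⟨x.2.extend (hne x hx).1 Finset.sdiff_disjoint (hne x hx).2, x.1⟩) ?_ ?_ ?_ ?_
  · intro x hx
    simp
  · rintro ⟨B, P⟩ hx ⟨B', P'⟩ hx' h
    simp only [Sigma.mk.injEq, heq_eq_eq] at h
    obtain ⟨h, rfl⟩ := h
    have h2 := congrArg (fun Q => Q.parts.erase B) h
    simp only [Finpartition.extend_parts] at h2
    rw [Finset.erase_insert (hnot _ (hne _ hx).1 _),
      Finset.erase_insert (hnot _ (hne _ hx').1 _)] at h2
    rw [Finpartition.ext h2]
  · rintro ⟨P, B⟩ hx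
    have hB : B ∈ P.parts := by simpa using hx
    have hsup : (P.parts.erase B).sup id = S \ B := by
      have h1 : B ⊔ (P.parts.erase B).sup id = S := by
        conv_rhs => rw [← P.sup_parts, ← Finset.insert_erase hB, Finset.sup_insert]
        rfl
      have h2 : Disjoint B ((P.parts.erase B).sup id) := by
        rw [Finset.disjoint_sup_right]
        intro B' hB'
        rw [Finset.mem_erase] at hB'
        exact P.disjoint hB hB'.2 hB'.1.symm
      conv_rhs => rw [← h1]
      exact (Finset.union_sdiff_cancel_left h2).symm
    refine ⟨⟨B, P.ofSubset (Finset.erase_subset _ _) hsup⟩, ?_, ?_⟩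
    · simp only [Finset.mem_sigma, Finset.mem_erase, Finset.mem_powerset, Finset.mem_univ,
        and_true]
      exact ⟨P.ne_bot hB, P.le hB⟩
    · simp only [Sigma.mk.injEq, heq_eq_eq, and_true]
      ext1
      simp [Finset.insert_erase hB]
  · rintro ⟨B, P⟩ hx
    simp only [Finpartition.extend_parts]
    rw [Finset.erase_insert (hnot _ (hne _ hx).1 _)]

end Partitions

/-! ### Squarefree generating polynomials and the exponential formula -/

section Generating

variable {ι : Type} [DecidableEq ι]

/-- The exponent of the squarefree monomial `∏ i ∈ S, x_i`. -/
def expo (S : Finset ι) : ι →₀ ℕ := Finsupp.indicator S fun _ _ => 1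

theorem expo_apply (S : Finset ι) (i : ι) : expo S i = if i ∈ S then 1 else 0 := by
  simp [expo, Finsupp.indicator_apply]

theorem expo_le_expo {S T : Finset ι} : expo S ≤ expo T ↔ S ⊆ T := by
  constructor
  · intro h i hi
    have := h i
    by_contra hiT
    simp [expo_apply, hi, hiT] at this
  · intro h i
    by_cases hi : i ∈ S
    · simp [expo_apply, hi, h hi]
    · simp [expo_apply, hi]

theorem expo_sub_expo (S T : Finset ι) : expo S - expo T = expo (S \ T) := by
  ext i
  by_cases hS : i ∈ S <;> by_cases hT : i ∈ T <;> simp [expo_apply, hS, hT]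

theorem expo_injective : Function.Injective (expo : Finset ι → ι →₀ ℕ) := fun _ _ h =>
  Finset.Subset.antisymm (expo_le_expo.mp h.le) (expo_le_expo.mp h.ge)

theorem expo_empty : expo (∅ : Finset ι) = 0 := by
  ext i; simp [expo_apply]

theorem eq_expo_support {S : Finset ι} {v : ι →₀ ℕ} (h : v ≤ expo S) :
    v = expo v.support ∧ v.support ⊆ S := by
  have hv : ∀ i, v i ≤ if i ∈ S then 1 else 0 := fun i => (h i).trans_eq (expo_apply S i)
  constructor
  · ext i
    have := hv i
    rw [expo_apply]
    by_cases hi : v i = 0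
    · simp [hi]
    · rw [if_pos (by simpa using hi)]
      split_ifs at this <;> omega
  · intro i hi
    have := hv i
    by_contra hiS
    simp [hiS] at this
    simp [this] at hi

/-- If the coefficients of `w` below `S` vanish, that of a product with `w` at `S` is the one of
`w` times the constant coefficient of the other factor. -/
theorem coeff_mul_of_forall_ssubset {w g : MvPolynomial ι ℂ} {S : Finset ι}
    (hw : ∀ S', S' ⊂ S → w.coeff (expo S') = 0) :
    (w * g).coeff (expo S) = w.coeff (expo S) * g.coeff 0 := by
  rw [MvPolynomial.coeff_mul, Finset.sum_eq_single (expo S, 0)]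
  · rintro ⟨u, v⟩ huv hne
    rw [Finset.HasAntidiagonal.mem_antidiagonal] at huv
    have hu := eq_expo_support (S := S) (v := u) (huv ▸ le_self_add)
    simp only at huv ⊢
    rw [hu.1, hw _ (hu.2.ssubset_of_ne ?_), zero_mul]
    intro h
    rw [h] at hu
    apply hne
    rw [hu.1] at huv ⊢
    simpa using huv
  · intro h
    simp at h

variable [Fintype ι]

/-- The polynomial `∑ S, J S * ∏ i ∈ S, x_i`. -/
def genPoly (J : Finset ι → ℂ) : MvPolynomial ι ℂ := ∑ S, MvPolynomial.monomial (expo S) (J S)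

theorem coeff_genPoly (J : Finset ι → ℂ) (S : Finset ι) :
    (genPoly J).coeff (expo S) = J S := by
  simp [genPoly, MvPolynomial.coeff_sum, MvPolynomial.coeff_monomial, expo_injective.eq_iff]

theorem coeff_genPoly_mul {g : Finset ι → ℂ} (hg : g ∅ = 0) (f : MvPolynomial ι ℂ)
    (S : Finset ι) :
    (genPoly g * f).coeff (expo S) =
      ∑ B ∈ S.powerset.erase ∅, g B * f.coeff (expo (S \ B)) := by
  rw [Finset.sum_erase _ (by simp [hg]), genPoly, Finset.sum_mul, MvPolynomial.coeff_sum]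
  simp only [MvPolynomial.coeff_monomial_mul', expo_le_expo, expo_sub_expo]
  rw [← Finset.sum_filter]
  congr 1
  ext B
  simp

/-- The exponential formula. -/
theorem coeff_genPoly_pow {J : Finset ι → ℂ} (hJ : J ∅ = 0) (k : ℕ) (S : Finset ι) :
    (genPoly J ^ k).coeff (expo S) =
      (k.factorial : ℂ) *
        ∑ P : Finpartition S, if P.parts.card = k then ∏ B ∈ P.parts, J B else 0 := by
  induction k generalizing S with
  | zero =>
    rw [pow_zero, MvPolynomial.coeff_one]
    by_cases hS : S = ∅
    · subst hS
      have : ∀ P : Finpartition (∅ : Finset ι), P.parts = ∅ :=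
        fun P => Finpartition.parts_eq_empty_iff.mpr rfl
      have hu : Unique (Finpartition (∅ : Finset ι)) :=
        inferInstanceAs (Unique (Finpartition (⊥ : Finset ι)))
      rw [Fintype.sum_eq_single hu.default (fun x hx => (hx (hu.eq_default x)).elim)]
      simp [expo_empty, this]
    · have h1 : ∀ P : Finpartition S, P.parts.card ≠ 0 := by
        intro P h
        rw [Finset.card_eq_zero, Finpartition.parts_eq_empty_iff] at h
        exact hS h
      have h2 : 0 ≠ expo S := by
        rw [← expo_empty]
        exact fun h => hS (expo_injective h).symm
      simp [h1, h2]
  | succ k ih =>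
    rw [pow_succ', coeff_genPoly_mul hJ]
    simp only [ih]
    have h := sum_finpartition_sum_parts S
      (fun B Q => J B * if Q.card = k then ∏ B ∈ Q, J B else 0)
    simp only [← Finset.mul_sum] at h
    simp only [mul_left_comm _ (k.factorial : ℂ), ← Finset.mul_sum]
    rw [← h, Nat.factorial_succ, Nat.cast_mul, mul_comm ((k + 1 : ℕ) : ℂ), mul_assoc]
    congr 1
    rw [Finset.mul_sum]
    refine Finset.sum_congr rfl fun P _ => ?_
    have h3 : ∀ B ∈ P.parts, (J B * if (P.parts.erase B).card = k then
        ∏ B ∈ P.parts.erase B, J B else 0) =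
        if P.parts.card = k + 1 then ∏ B ∈ P.parts, J B else 0 := by
      intro B hB
      have h4 : (P.parts.erase B).card = k ↔ P.parts.card = k + 1 := by
        have := Finset.card_erase_add_one hB
        omega
      simp only [h4, mul_ite, Finset.mul_prod_erase _ _ hB, mul_zero]
    -- Each of the `k + 1` possible marked parts gives the same summand; this turns `k!` into `(k +
    -- 1)!`.
    rw [Finset.sum_congr rfl h3, Finset.sum_const, nsmul_eq_mul]
    split_ifs with h5
    · rw [h5]
    · simp

/-- The first factor marks a part and weights it by `f`; summing over the marks yields `∑ f B`. With
`f` the squared momentum, this produces the contribution of the lower legs of a vertex. -/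
theorem coeff_genPoly_mul_pow {J : Finset ι → ℂ} (hJ : J ∅ = 0) (f : Finset ι → ℂ) (k : ℕ)
    (S : Finset ι) :
    (genPoly (fun B => f B * J B) * genPoly J ^ k).coeff (expo S) =
      (k.factorial : ℂ) * ∑ P : Finpartition S,
        if P.parts.card = k + 1 then (∑ B ∈ P.parts, f B) * ∏ B ∈ P.parts, J B else 0 := by
  rw [coeff_genPoly_mul (by simp [hJ])]
  simp only [coeff_genPoly_pow hJ]
  have h := sum_finpartition_sum_parts S
    (fun B Q => f B * J B * if Q.card = k then ∏ B ∈ Q, J B else 0)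
  simp only [← Finset.mul_sum] at h
  simp only [mul_left_comm _ (k.factorial : ℂ), ← Finset.mul_sum]
  rw [← h]
  congr 1
  refine Finset.sum_congr rfl fun P _ => ?_
  have h3 : ∀ B ∈ P.parts, (f B * J B * if (P.parts.erase B).card = k then
      ∏ B ∈ P.parts.erase B, J B else 0) =
      f B * if P.parts.card = k + 1 then ∏ B ∈ P.parts, J B else 0 := by
    intro B hB
    have h4 : (P.parts.erase B).card = k ↔ P.parts.card = k + 1 := by
      have := Finset.card_erase_add_one hB
      omega
    simp only [h4, mul_ite, mul_assoc, Finset.mul_prod_erase _ _ hB, mul_zero]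
  rw [Finset.sum_congr rfl h3, ← Finset.sum_mul]
  split_ifs <;> simp

end Generating

/-! ### The field equation and its covariance -/

section FieldEquation

variable {ι : Type} {d : ℕ}

/-- The derivation which multiplies the monomial `x^u` by the momentum component `∑ i, u i p_i`. -/
def momentumDer (p : ι → Momentum d) (μ : Fin (d + 1)) :
    Derivation ℂ (MvPolynomial ι ℂ) (MvPolynomial ι ℂ) :=
  MvPolynomial.mkDerivation ℂ fun i => MvPolynomial.C (p i μ) * MvPolynomial.X i

/-- The diagonal of the Minkowski metric. -/
def metric {d : ℕ} (μ : Fin (d + 1)) : ℂ := if μ = 0 then 1 else -1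

/-- The d'Alembert operator, up to sign. -/
def box (p : ι → Momentum d) (f : MvPolynomial ι ℂ) : MvPolynomial ι ℂ :=
  ∑ μ, metric μ • momentumDer p μ (momentumDer p μ f)

/-- The square of the gradient, up to sign. -/
def gradSq (p : ι → Momentum d) (f : MvPolynomial ι ℂ) : MvPolynomial ι ℂ :=
  ∑ μ, metric μ • momentumDer p μ f ^ 2

theorem mdot_eq_sum (q q' : Momentum d) : mdot q q' = ∑ μ, metric μ * (q μ * q' μ) := by
  simp [mdot, Fin.sum_univ_succ, metric, Fin.succ_ne_zero, sub_eq_add_neg]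

theorem coeff_momentumDer [DecidableEq ι] (p : ι → Momentum d) (μ : Fin (d + 1)) (f : MvPolynomial ι ℂ)
    (u : ι →₀ ℕ) :
    (momentumDer p μ f).coeff u = (u.sum fun i k => (k : ℂ) * p i μ) * f.coeff u := by
  induction f using MvPolynomial.induction_on' with
  | add f g hf hg => rw [map_add, MvPolynomial.coeff_add, hf, hg, MvPolynomial.coeff_add, mul_add]
  | monomial v c =>
    rw [momentumDer, MvPolynomial.mkDerivation_monomial]
    have h : ∀ i ∈ v.support, MvPolynomial.monomial (v - Finsupp.single i 1) ((v i : ℕ) : ℂ) •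
        (MvPolynomial.C (p i μ) * MvPolynomial.X i) =
        MvPolynomial.monomial v ((v i : ℂ) * p i μ) := by
      intro i hi
      have hle : Finsupp.single i 1 ≤ v := by
        rw [Finsupp.single_le_iff]
        exact Nat.one_le_iff_ne_zero.mpr (by simpa using hi)
      rw [smul_eq_mul, mul_left_comm, MvPolynomial.X, MvPolynomial.monomial_mul,
        MvPolynomial.C_mul_monomial, tsub_add_cancel_of_le hle]
      congr 1
      ring
    rw [Finsupp.sum, Finset.sum_congr rfl h]
    rw [MvPolynomial.coeff_smul, MvPolynomial.coeff_sum, MvPolynomial.coeff_monomial]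
    simp only [MvPolynomial.coeff_monomial]
    split_ifs with hvu
    · subst hvu
      rw [Finsupp.sum, smul_eq_mul, mul_comm]
    · simp

theorem coeff_momentumDer_expo [DecidableEq ι] (p : ι → Momentum d) (μ : Fin (d + 1)) (f : MvPolynomial ι ℂ)
    (S : Finset ι) :
    (momentumDer p μ f).coeff (expo S) = inflow p S μ * f.coeff (expo S) := by
  rw [coeff_momentumDer]
  congr 1
  rw [Finsupp.sum_of_support_subset (expo S) (s := S) (Finsupp.support_indicator_subset _ _) _
    (by simp), inflow, Finset.sum_apply]
  refine Finset.sum_congr rfl fun i hi => ?_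
  simp [expo_apply, hi]

theorem coeff_box [DecidableEq ι] (p : ι → Momentum d) (f : MvPolynomial ι ℂ) (S : Finset ι) :
    (box p f).coeff (expo S) = mdot (inflow p S) (inflow p S) * f.coeff (expo S) := by
  simp only [box, MvPolynomial.coeff_sum, MvPolynomial.coeff_smul, coeff_momentumDer_expo,
    mdot_eq_sum, Finset.sum_mul, smul_eq_mul]
  refine Finset.sum_congr rfl fun i hi => ?_
  ring

theorem box_aeval (p : ι → Momentum d) (f : MvPolynomial ι ℂ) (Φ : Polynomial ℂ) :
    box p (Polynomial.aeval f Φ) = Polynomial.aeval f (Polynomial.derivative Φ) * box p f +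
      Polynomial.aeval f (Polynomial.derivative (Polynomial.derivative Φ)) * gradSq p f := by
  simp only [box, gradSq, Finset.mul_sum, ← Finset.sum_add_distrib]
  refine Finset.sum_congr rfl fun μ _ => ?_
  simp only [Derivation.map_aeval, Derivation.leibniz, smul_eq_mul, mul_smul_comm, ← smul_add]
  congr 1
  ring

/-- The field equation of the Lagrangian `½ K(φ) ∂_μφ ∂^μφ - U(φ)`. -/
def fieldEq (p : ι → Momentum d) (K U : Polynomial ℂ) (f : MvPolynomial ι ℂ) :
    MvPolynomial ι ℂ :=
  Polynomial.aeval f K * box p f +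
    MvPolynomial.C (1 / 2) * Polynomial.aeval f (Polynomial.derivative K) * gradSq p f -
    Polynomial.aeval f (Polynomial.derivative U)

/-- Covariance of the field equation under field redefinitions. -/
theorem fieldEq_comp (p : ι → Momentum d) (U Φ : Polynomial ℂ) (f : MvPolynomial ι ℂ) :
    fieldEq p (Polynomial.derivative Φ ^ 2) (U.comp Φ) f =
      fieldEq p 1 U (Polynomial.aeval f Φ) * Polynomial.aeval f (Polynomial.derivative Φ) := by
  have h2 : (MvPolynomial.C (1 / 2) : MvPolynomial ι ℂ) * 2 = 1 := by
    rw [← map_ofNat (MvPolynomial.C (σ := ι) (R := ℂ)) 2, ← map_mul]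
    norm_num
  simp only [fieldEq, Polynomial.derivative_one, map_one, map_zero, box_aeval,
    Polynomial.derivative_comp, map_mul, Polynomial.aeval_comp, Polynomial.derivative_pow,
    map_pow]
  simp only [Nat.add_one_sub_one, pow_one, Nat.cast_ofNat, map_ofNat]
  -- Since `½ (Φ'²)' = Φ' Φ''`, the gradient term matches the one from the chain rule for `box`.
  linear_combination (Polynomial.aeval f (Polynomial.derivative Φ) *
    Polynomial.aeval f (Polynomial.derivative (Polynomial.derivative Φ)) * gradSq p f) * h2

end FieldEquation

/-! ### Coefficients of the field equation as vertex sums -/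

section FieldEquationCoefficients

variable {ι : Type} {d : ℕ}

/-- The truncated exponent `j - 1` at `j = 0` is harmless because of the factor `j`. -/
theorem box_pow_succ (p : ι → Momentum d) (f : MvPolynomial ι ℂ) (j : ℕ) :
    box p (f ^ (j + 1)) =
      ((j : MvPolynomial ι ℂ) + 1) * (f ^ j * box p f + j * f ^ (j - 1) * gradSq p f) := by
  have h := box_aeval p f (Polynomial.X ^ (j + 1))
  simp only [map_pow, Polynomial.aeval_X, Polynomial.derivative_X_pow, Polynomial.derivative_mul,
    Polynomial.derivative_natCast, map_mul, map_add, map_natCast, Nat.cast_add,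
    Nat.cast_one, map_one, Nat.add_sub_cancel, zero_mul, zero_add,
    Polynomial.derivative_one] at h
  rw [h]
  ring

theorem aeval_derivative_eq_sum (f : MvPolynomial ι ℂ) {U : Polynomial ℂ} {N : ℕ}
    (hU : U.natDegree < N) :
    Polynomial.aeval f (Polynomial.derivative U) =
      ∑ j ∈ Finset.range N, MvPolynomial.C (U.coeff (j + 1) * (j + 1)) * f ^ j := by
  rw [Polynomial.aeval_eq_sum_range'
    (lt_of_le_of_lt ((Polynomial.natDegree_derivative_le U).trans (Nat.sub_le _ _)) hU)]
  simp only [Polynomial.coeff_derivative, MvPolynomial.smul_eq_C_mul]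

/-- `box_pow_succ` eliminates the gradient. What is left matches the Feynman rule: `box p (f ^ (j +
1))` gives the squared momentum of the upper leg, `box p f * f ^ j` those of the lower legs. -/
theorem kinetic_eq_sum (p : ι → Momentum d) (f : MvPolynomial ι ℂ) {K : Polynomial ℂ} {N : ℕ}
    (hK : K.natDegree < N) :
    Polynomial.aeval f K * box p f +
        MvPolynomial.C (1 / 2) * Polynomial.aeval f (Polynomial.derivative K) * gradSq p f =
      ∑ j ∈ Finset.range N, MvPolynomial.C (K.coeff j / 2) *
        (MvPolynomial.C (1 / ((j : ℂ) + 1)) * box p (f ^ (j + 1)) + box p f * f ^ j) := by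
  have h1 := Polynomial.aeval_eq_sum_range' hK f
  have h2 : Polynomial.aeval f (Polynomial.derivative K) =
      ∑ j ∈ Finset.range N, MvPolynomial.C (K.coeff j * j) * f ^ (j - 1) := by
    conv_lhs => rw [K.as_sum_range' N hK]
    simp [Polynomial.derivative_monomial, Polynomial.aeval_monomial]
  rw [h1, h2, Finset.sum_mul, Finset.mul_sum, Finset.sum_mul, ← Finset.sum_add_distrib]
  refine Finset.sum_congr rfl fun j _ => ?_
  have h3 : (MvPolynomial.C (1 / ((j : ℂ) + 1)) : MvPolynomial ι ℂ) *
      ((j : MvPolynomial ι ℂ) + 1) = 1 := by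
    have : ((j : MvPolynomial ι ℂ) + 1) = MvPolynomial.C ((j : ℂ) + 1) := by simp
    rw [this, ← map_mul, one_div, inv_mul_cancel₀ (Nat.cast_add_one_ne_zero j), map_one]
  have h4 : (MvPolynomial.C (K.coeff j) : MvPolynomial ι ℂ) =
      2 * MvPolynomial.C (K.coeff j / 2) := by
    rw [← map_ofNat (MvPolynomial.C (σ := ι) (R := ℂ)) 2, ← map_mul]
    congr 1; ring
  have h5 : (MvPolynomial.C (1 / 2) * MvPolynomial.C (K.coeff j * j) : MvPolynomial ι ℂ) =
      MvPolynomial.C (K.coeff j / 2) * (j : MvPolynomial ι ℂ) := by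
    rw [← map_mul, ← map_natCast (MvPolynomial.C (σ := ι) (R := ℂ)) j, ← map_mul]
    congr 1; ring
  rw [box_pow_succ, MvPolynomial.smul_eq_C_mul, h4]
  linear_combination (f ^ (j - 1) * gradSq p f) * h5 - MvPolynomial.C (K.coeff j / 2) *
    (f ^ j * box p f + j * f ^ (j - 1) * gradSq p f) * h3

variable [DecidableEq ι]

theorem box_genPoly [Fintype ι] (p : ι → Momentum d) (J : Finset ι → ℂ) :
    box p (genPoly J) = genPoly fun S => mdot (inflow p S) (inflow p S) * J S := by
  ext u
  by_cases hu : ∃ S, u = expo S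
  · obtain ⟨S, rfl⟩ := hu
    rw [coeff_box, coeff_genPoly, coeff_genPoly]
  · have h : ∀ J : Finset ι → ℂ, (genPoly J).coeff u = 0 := by
      intro J
      rw [genPoly, MvPolynomial.coeff_sum]
      refine Finset.sum_eq_zero fun S _ => ?_
      rw [MvPolynomial.coeff_monomial, if_neg fun h => hu ⟨S, h.symm⟩]
    simp [box, MvPolynomial.coeff_sum, MvPolynomial.coeff_smul, coeff_momentumDer, h]

theorem sum_inflow_parts (p : ι → Momentum d) {S : Finset ι} (P : Finpartition S) :
    ∑ B ∈ P.parts, inflow p B = inflow p S := by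
  simp only [inflow]
  conv_rhs => rw [← P.biUnion_parts]
  rw [Finset.sum_biUnion P.disjoint]
  rfl

theorem vertex_legMomentum (L : Lagrangian) (p : ι → Momentum d) {S : Finset ι}
    (P : Finpartition S) :
    L.vertex (legMomentum p P) = Complex.I *
      (1 / 2 * ((P.parts.card - 1).factorial : ℂ) * coeff (P.parts.card - 1) L.kin *
        (mdot (inflow p S) (inflow p S) + ∑ B ∈ P.parts, mdot (inflow p B) (inflow p B)) -
      ((P.parts.card + 1).factorial : ℂ) * coeff (P.parts.card + 1) L.pot) := by
  have hc : Fintype.card (Option {B // B ∈ P.parts}) = P.parts.card + 1 := by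
    rw [Fintype.card_option, Fintype.card_coe]
  have h0 : ∑ i, legMomentum p P i = 0 := by
    rw [Fintype.sum_option]
    simp only [legMomentum]
    rw [Finset.sum_coe_sort P.parts (fun B => inflow p B), sum_inflow_parts, neg_add_cancel]
  have hneg : mdot (-inflow p S) (-inflow p S) = mdot (inflow p S) (inflow p S) := by
    simp [mdot]
  rw [Lagrangian.vertex, sum_offDiag_mdot _ h0, hc, Fintype.sum_option]
  simp only [legMomentum, hneg]
  rw [Finset.sum_coe_sort P.parts (fun B => mdot (inflow p B) (inflow p B)),
    show P.parts.card + 1 - 2 = P.parts.card - 1 by omega]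
  ring

/-- Every partition of `S` has at most `S.card` parts, so exactly one power of the field contributes
it. -/
theorem sum_range_sum_ite_card {S : Finset ι} (F : Finpartition S → ℂ) (c : ℕ → ℂ) {N : ℕ}
    (hN : S.card < N) :
    ∑ j ∈ Finset.range N, c j * ∑ P : Finpartition S, (if P.parts.card = j then F P else 0) =
      ∑ P : Finpartition S, c P.parts.card * F P := by
  simp only [Finset.mul_sum]
  rw [Finset.sum_comm]
  refine Finset.sum_congr rfl fun P _ => ?_
  have := P.card_parts_le_card
  rw [Finset.sum_eq_single P.parts.card]
  · simp
  · intro j _ hj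
    simp [hj.symm]
  · intro h
    exact absurd (Finset.mem_range.mpr (by omega)) h

theorem sum_range_sum_ite_card_succ {S : Finset ι} (hS : S.Nonempty) (F : Finpartition S → ℂ)
    (c : ℕ → ℂ) {N : ℕ} (hN : S.card < N) :
    ∑ j ∈ Finset.range N,
        c j * ∑ P : Finpartition S, (if P.parts.card = j + 1 then F P else 0) =
      ∑ P : Finpartition S, c (P.parts.card - 1) * F P := by
  simp only [Finset.mul_sum]
  rw [Finset.sum_comm]
  refine Finset.sum_congr rfl fun P _ => ?_
  have h1 := P.card_parts_le_card
  have h2 : 0 < P.parts.card := Finset.card_pos.mpr (P.parts_nonempty hS.ne_empty)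
  rw [Finset.sum_eq_single (P.parts.card - 1)]
  · rw [if_pos (by omega)]
  · intro j _ hj
    rw [if_neg (by omega), mul_zero]
  · intro h
    exact absurd (Finset.mem_range.mpr (by omega)) h

/-- The coefficients of the field equation are sums over the possible uppermost vertices, where
the two-valent vertex is the inverse propagator. -/
theorem coeff_fieldEq_genPoly [Fintype ι] (L : Lagrangian) (p : ι → Momentum d)
    {J : Finset ι → ℂ} (hJ : J ∅ = 0) {K U : Polynomial ℂ} {S : Finset ι} (hS : S.Nonempty)
    (hK : ∀ j < S.card, K.coeff j = coeff j L.kin)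
    (hU : ∀ j ≤ S.card + 1, U.coeff j = coeff j L.pot) :
    Complex.I * (fieldEq p K U (genPoly J)).coeff (expo S) =
      ∑ P : Finpartition S, L.vertex (legMomentum p P) * ∏ B ∈ P.parts, J B := by
  -- One summation range beyond both degrees and all numbers of parts.
  obtain ⟨N, hN⟩ : ∃ N, N = K.natDegree + U.natDegree + S.card + 1 := ⟨_, rfl⟩
  rw [fieldEq, kinetic_eq_sum p _ (N := N) (by omega), aeval_derivative_eq_sum _ (N := N)
    (by omega)]
  simp only [MvPolynomial.coeff_sub, MvPolynomial.coeff_sum, MvPolynomial.coeff_C_mul,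
    MvPolynomial.coeff_add, coeff_box, box_genPoly, coeff_genPoly_mul_pow hJ,
    coeff_genPoly_pow hJ]
  have h1 : ∀ j : ℕ, K.coeff j / 2 * (1 / ((j : ℂ) + 1) * (mdot (inflow p S) (inflow p S) *
      (((j + 1).factorial : ℂ) * ∑ P : Finpartition S,
        if P.parts.card = j + 1 then ∏ B ∈ P.parts, J B else 0)) +
      (j.factorial : ℂ) * ∑ P : Finpartition S, if P.parts.card = j + 1 then
        (∑ B ∈ P.parts, mdot (inflow p B) (inflow p B)) * ∏ B ∈ P.parts, J B else 0) =
      (K.coeff j / 2 * j.factorial) * ∑ P : Finpartition S, if P.parts.card = j + 1 then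
        (mdot (inflow p S) (inflow p S) + ∑ B ∈ P.parts, mdot (inflow p B) (inflow p B)) *
          ∏ B ∈ P.parts, J B else 0 := by
    intro j
    have hj : ((j : ℂ) + 1) ≠ 0 := Nat.cast_add_one_ne_zero j
    have h2 : ∀ P : Finpartition S, (if P.parts.card = j + 1 then
        (mdot (inflow p S) (inflow p S) + ∑ B ∈ P.parts, mdot (inflow p B) (inflow p B)) *
          ∏ B ∈ P.parts, J B else 0) =
        mdot (inflow p S) (inflow p S) *
          (if P.parts.card = j + 1 then ∏ B ∈ P.parts, J B else 0) +
        if P.parts.card = j + 1 then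
          (∑ B ∈ P.parts, mdot (inflow p B) (inflow p B)) * ∏ B ∈ P.parts, J B else 0 := by
      intro P
      split_ifs <;> ring
    simp only [h2]
    rw [Finset.sum_add_distrib, ← Finset.mul_sum, Nat.factorial_succ]
    push_cast
    field_simp
  simp only [h1]
  simp only [← mul_assoc]
  rw [sum_range_sum_ite_card_succ hS _ (fun j => K.coeff j / 2 * j.factorial) (by omega),
    sum_range_sum_ite_card _ (fun j => U.coeff (j + 1) * ((j : ℂ) + 1) * j.factorial) (by omega),
    ← Finset.sum_sub_distrib, Finset.mul_sum]
  refine Finset.sum_congr rfl fun P _ => ?_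
  have h2 := P.card_parts_le_card
  have h3 : 0 < P.parts.card := Finset.card_pos.mpr (P.parts_nonempty hS.ne_empty)
  rw [vertex_legMomentum, hK _ (by omega), hU _ (by omega), Nat.factorial_succ P.parts.card]
  push_cast
  ring

end FieldEquationCoefficients

/-! ### Tree sums as solutions of the field equation -/

section Currents

variable {ι : Type} [DecidableEq ι] {d : ℕ}

/-- A tree is an external edge or consists of an uppermost vertex and the trees below it. -/
def FeynTree.equivSum (S : Finset ι) :
    FeynTree S ≃ {i // S = {i}} ⊕ (Σ P : {P : Finpartition S // 2 ≤ P.parts.card},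
      ∀ B : {B // B ∈ P.1.parts}, FeynTree B.1) where
  toFun
    | .leaf i h => Sum.inl ⟨i, h⟩
    | .node P h c => Sum.inr ⟨⟨P, h⟩, c⟩
  invFun
    | Sum.inl x => .leaf x.1 x.2
    | Sum.inr x => .node x.1.1 x.1.2 x.2
  left_inv t := by cases t <;> rfl
  right_inv x := by rcases x with x | x <;> rfl

/-- The sum of all trees with external edges `S` below an edge which is not amputated. -/
def current (L : Lagrangian) (p : ι → Momentum d) (S : Finset ι) : ℂ :=
  ∑ t : FeynTree S, t.edgeFactor L p * t.amplitude L p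

theorem current_empty (L : Lagrangian) (p : ι → Momentum d) : current L p ∅ = 0 := by
  refine Finset.sum_eq_zero fun t _ => ?_
  cases t with
  | leaf i h => simp at h
  | node P h c => simp [Finpartition.parts_eq_empty_iff.mpr rfl] at h

theorem current_singleton (L : Lagrangian) (p : ι → Momentum d) (i : ι) :
    current L p {i} = 1 := by
  rw [current, Fintype.sum_eq_single (FeynTree.leaf i rfl)]
  · simp [FeynTree.edgeFactor, FeynTree.amplitude]
  · intro t ht
    cases t with
    | leaf j h =>
      obtain rfl := Finset.singleton_injective h
      exact absurd rfl ht
    | node P h c =>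
      have := P.card_parts_le_card
      rw [Finset.card_singleton] at this
      omega

theorem sum_feynTree_of_two_le_card {S : Finset ι} (hS : 2 ≤ S.card) (F : FeynTree S → ℂ) :
    ∑ t, F t = ∑ P : {P : Finpartition S // 2 ≤ P.parts.card},
      ∑ c : ∀ B : {B // B ∈ P.1.parts}, FeynTree B.1, F (.node P.1 P.2 c) := by
  have : IsEmpty {i // S = {i}} := ⟨fun i => by
    have := congrArg Finset.card i.2
    rw [Finset.card_singleton] at this
    omega⟩
  have : Fintype {i // S = {i}} := Fintype.ofIsEmpty
  rw [← Equiv.sum_comp (FeynTree.equivSum S).symm F, Fintype.sum_sum_type, Fintype.sum_empty,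
    zero_add, Fintype.sum_sigma]
  rfl

theorem sum_amplitude (L : Lagrangian) (p : ι → Momentum d) {S : Finset ι} (hS : 2 ≤ S.card) :
    ∑ t : FeynTree S, t.amplitude L p =
      ∑ P : Finpartition S, if 2 ≤ P.parts.card then
        L.vertex (legMomentum p P) * ∏ B ∈ P.parts, current L p B else 0 := by
  rw [sum_feynTree_of_two_le_card hS, ← Finset.sum_filter,
    ← Finset.sum_subtype_eq_sum_filter, Finset.subtype_univ]
  refine Finset.sum_congr rfl fun P _ => ?_
  simp only [FeynTree.amplitude]
  rw [← Finset.mul_sum, ← Finset.prod_coe_sort]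
  simp only [current]
  rw [Finset.prod_univ_sum, Fintype.piFinset_univ]

theorem current_eq_propagator_mul (L : Lagrangian) (p : ι → Momentum d) {S : Finset ι}
    (hS : 2 ≤ S.card) :
    current L p S = L.propagator (inflow p S) * ∑ t : FeynTree S, t.amplitude L p := by
  rw [current, sum_feynTree_of_two_le_card hS, sum_feynTree_of_two_le_card hS]
  simp only [FeynTree.edgeFactor, Finset.mul_sum]

/-- The one-part partition is the two-valent vertex, which is no vertex of a tree; split off, it
gives the kinetic operator acting on `J S`. -/
theorem sum_vertex_mul_prod (L : Lagrangian) (p : ι → Momentum d) (J : Finset ι → ℂ)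
    {S : Finset ι} (hS : S.Nonempty) :
    ∑ P : Finpartition S, L.vertex (legMomentum p P) * ∏ B ∈ P.parts, J B =
      Complex.I * (coeff 0 L.kin * mdot (inflow p S) (inflow p S) - 2 * coeff 2 L.pot) * J S +
      ∑ P : Finpartition S, if 2 ≤ P.parts.card then
        L.vertex (legMomentum p P) * ∏ B ∈ P.parts, J B else 0 := by
  have hS' : S ≠ ⊥ := hS.ne_empty
  rw [← Finset.add_sum_erase _ _ (Finset.mem_univ (Finpartition.indiscrete hS'))]
  congr 1
  · simp only [vertex_legMomentum, Finpartition.indiscrete_parts, Finset.card_singleton,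
      Finset.sum_singleton, Finset.prod_singleton, Nat.sub_self, Nat.factorial_zero,
      Nat.reduceAdd, Nat.factorial_two]
    push_cast
    ring
  · symm
    rw [← Finset.sum_erase (a := Finpartition.indiscrete hS') _
      (if_neg (by simp [Finpartition.indiscrete_parts]))]
    symm
    refine Finset.sum_congr rfl fun P hP => ?_
    rw [if_pos]
    have h0 : 0 < P.parts.card := Finset.card_pos.mpr (P.parts_nonempty hS.ne_empty)
    by_contra h2
    obtain ⟨B, hB⟩ := Finset.card_eq_one.mp (show P.parts.card = 1 by omega)
    refine (Finset.mem_erase.mp hP).1 (Finpartition.ext ?_)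
    have := P.sup_parts
    rw [hB, Finset.sup_singleton] at this
    rw [hB, Finpartition.indiscrete_parts, ← this]
    rfl

/-- The currents solve the field equation below the top, and the amplitude is the obstruction to
solving it where the propagator is singular. -/
theorem coeff_fieldEq_current [Fintype ι] (L : Lagrangian) {m : ℝ} (p : ι → Momentum d)
    (hprop : ∀ q : Momentum d, L.propagator q = Complex.I / offshell m q)
    {K U : Polynomial ℂ} {S : Finset ι} (hS : S.Nonempty)
    (hK : ∀ j < S.card, K.coeff j = coeff j L.kin)
    (hU : ∀ j ≤ S.card + 1, U.coeff j = coeff j L.pot) :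
    Complex.I * (fieldEq p K U (genPoly (current L p))).coeff (expo S) =
      Complex.I * offshell m (inflow p S) * current L p S +
        ∑ P : Finpartition S, if 2 ≤ P.parts.card then
          L.vertex (legMomentum p P) * ∏ B ∈ P.parts, current L p B else 0 := by
  have h := hprop (inflow p S)
  -- Inversion is injective on `ℂ` even with `0⁻¹ = 0`, so equal propagators have equal
  -- denominators, also onshell.
  rw [Lagrangian.propagator, div_eq_mul_inv, div_eq_mul_inv] at h
  rw [coeff_fieldEq_genPoly L p (current_empty L p) hS hK hU, sum_vertex_mul_prod L p _ hS,
    inv_injective (mul_left_cancel₀ Complex.I_ne_zero h)]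

theorem coeff_fieldEq_current_eq_zero [Fintype ι] (L : Lagrangian) {m : ℝ} (p : ι → Momentum d)
    (hprop : ∀ q : Momentum d, L.propagator q = Complex.I / offshell m q)
    {K U : Polynomial ℂ} {S : Finset ι} (hS : S.Nonempty)
    (hK : ∀ j < S.card, K.coeff j = coeff j L.kin)
    (hU : ∀ j ≤ S.card + 1, U.coeff j = coeff j L.pot)
    (hon : S.card = 1 → offshell m (inflow p S) = 0)
    (hoff : 2 ≤ S.card → offshell m (inflow p S) ≠ 0) :
    (fieldEq p K U (genPoly (current L p))).coeff (expo S) = 0 := by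
  refine (mul_eq_zero.mp ?_).resolve_left Complex.I_ne_zero
  rw [coeff_fieldEq_current L p hprop hS hK hU]
  have hpos := hS.card_pos
  by_cases h1 : S.card = 1
  · rw [hon h1, mul_zero, zero_mul, zero_add]
    refine Finset.sum_eq_zero fun P _ => ?_
    have := P.card_parts_le_card
    rw [if_neg (by omega)]
  · have h2 : 2 ≤ S.card := by omega
    -- The inverse propagator `i x` times the propagator `i / x` is `-1`, so the two terms cancel.
    rw [← sum_amplitude L p h2, current_eq_propagator_mul L p h2, hprop]
    have := hoff h2
    field_simp
    rw [Complex.I_sq]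
    ring

end Currents

/-! ### Dependence of coefficients on proper subsets -/

section FieldValues

variable {ι : Type}

theorem coeff_zero_aeval {f : MvPolynomial ι ℂ} (hf : f.coeff 0 = 0) (Q : Polynomial ℂ) :
    (Polynomial.aeval f Q).coeff 0 = Q.coeff 0 := by
  rw [← MvPolynomial.constantCoeff_eq] at hf ⊢
  rw [Polynomial.aeval_def, Polynomial.hom_eval₂, hf, Polynomial.eval₂_at_zero]
  simp [MvPolynomial.algebraMap_eq]

variable [DecidableEq ι]

theorem coeff_singleton_aeval {f : MvPolynomial ι ℂ} (hf : f.coeff 0 = 0) {Q : Polynomial ℂ}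
    (hQ : Q.coeff 0 = 0) (i : ι) :
    (Polynomial.aeval f Q).coeff (expo {i}) = f.coeff (expo {i}) * Q.coeff 1 := by
  have h : Q = Polynomial.X * Q.divX := by
    conv_lhs => rw [← Polynomial.X_mul_divX_add Q, hQ, map_zero, add_zero]
  have h0 : ∀ S', S' ⊂ {i} → f.coeff (expo S') = 0 := by
    intro S' hS'
    rw [Finset.ssubset_singleton_iff.mp hS', expo_empty, hf]
  conv_lhs => rw [h]
  rw [map_mul, Polynomial.aeval_X, coeff_mul_of_forall_ssubset h0, coeff_zero_aeval hf,
    Polynomial.coeff_divX]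

/-- In `f ^ k - g ^ k = (f - g) * ∑ f ^ i * g ^ (k - 1 - i)` the first factor vanishes strictly
below `S`, and the second has no constant term as `k ≥ 2`. Thus nonlinear terms never see the
coefficient at `S` itself. -/
theorem coeff_pow_congr {f g : MvPolynomial ι ℂ} (hf : f.coeff 0 = 0) (hg : g.coeff 0 = 0)
    {S : Finset ι} (hfg : ∀ S', S' ⊂ S → f.coeff (expo S') = g.coeff (expo S')) {k : ℕ}
    (hk : 2 ≤ k) : (f ^ k).coeff (expo S) = (g ^ k).coeff (expo S) := by
  rw [← sub_eq_zero, ← MvPolynomial.coeff_sub, ← (Commute.all f g).mul_geom_sum₂,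
    coeff_mul_of_forall_ssubset]
  · rw [← MvPolynomial.constantCoeff_eq] at hf hg ⊢
    rw [map_sum, Finset.sum_eq_zero, mul_zero]
    intro i hi
    rw [Finset.mem_range] at hi
    rw [map_mul, map_pow, map_pow, hf, hg, ← pow_add, zero_pow (by omega)]
  · intro S' hS'
    rw [MvPolynomial.coeff_sub, hfg S' hS', sub_self]

/-- The potential of `φ^s`-theory as a polynomial. -/
def phiPot (m : ℝ) (s : ℕ) (lam : ℂ) : Polynomial ℂ :=
  Polynomial.C ((m : ℂ) ^ 2 / 2) * Polynomial.X ^ 2 +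
    Polynomial.C (lam / (s.factorial : ℂ)) * Polynomial.X ^ s

theorem coeff_fieldEq_phiPot {d : ℕ} (m : ℝ) (s : ℕ) (lam : ℂ) (p : ι → Momentum d)
    (f : MvPolynomial ι ℂ) (S : Finset ι) :
    (fieldEq p 1 (phiPot m s lam) f).coeff (expo S) =
      offshell m (inflow p S) * f.coeff (expo S) -
        lam / (s.factorial : ℂ) * s * (f ^ (s - 1)).coeff (expo S) := by
  have h : fieldEq p 1 (phiPot m s lam) f = box p f - (MvPolynomial.C ((m : ℂ) ^ 2) * f +
      MvPolynomial.C (lam / (s.factorial : ℂ) * s) * f ^ (s - 1)) := by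
    have h2 : (MvPolynomial.C ((m : ℂ) ^ 2) : MvPolynomial ι ℂ) =
        MvPolynomial.C ((m : ℂ) ^ 2 / 2) * 2 := by
      rw [← map_ofNat (MvPolynomial.C (σ := ι) (R := ℂ)) 2, ← map_mul]
      congr 1; ring
    rw [h2]
    simp [fieldEq, phiPot, Polynomial.derivative_X_pow, MvPolynomial.algebraMap_eq]
    ring
  rw [h]
  simp only [MvPolynomial.coeff_sub, MvPolynomial.coeff_add, MvPolynomial.coeff_C_mul, coeff_box,
    offshell]
  ring

end FieldValues

/-! ### Truncating the diffeomorphism to a polynomial -/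

section Truncation

theorem coeff_trunc_pow (f : ℂ⟦X⟧) {N j : ℕ} (hj : j < N) (k : ℕ) :
    ((trunc N f) ^ k).coeff j = coeff j (f ^ k) := by
  have h := congrArg (fun q => q.coeff j) (trunc_trunc_pow f N k)
  simpa [coeff_trunc, hj, ← Polynomial.coe_pow, Polynomial.coeff_coe] using h

/-- Differentiation costs one degree of accuracy, hence the truncation at `N + 1`. -/
theorem coeff_derivative_trunc_sq (a : ℕ → ℂ) {N j : ℕ} (hj : j < N) (m : ℝ) (s : ℕ) (lam : ℂ) :
    (Polynomial.derivative (trunc (N + 1) (diffeo a)) ^ 2).coeff j =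
      coeff j ((phiTheory m s lam).pullback (diffeo a)).kin := by
  rw [pullback_phiTheory_kin, ← coeff_trunc_pow _ hj]
  congr 2
  exact (trunc_derivative _ _).symm

theorem coeff_phiPot_comp_trunc (a : ℕ → ℂ) {N j : ℕ} (hj : j < N) (m : ℝ) (s : ℕ) (lam : ℂ) :
    ((phiPot m s lam).comp (trunc N (diffeo a))).coeff j =
      coeff j ((phiTheory m s lam).pullback (diffeo a)).pot := by
  rw [pullback_phiTheory_pot]
  simp [phiPot, coeff_trunc_pow _ hj]

theorem coeff_phiPot (m : ℝ) (s : ℕ) (lam : ℂ) (j : ℕ) :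
    (phiPot m s lam).coeff j = coeff j (phiTheory m s lam).pot := by
  simp [phiPot, phiTheory, coeff_X_pow, Polynomial.coeff_X_pow]

theorem coeff_one_phiTheory_kin (m : ℝ) (s : ℕ) (lam : ℂ) (j : ℕ) :
    (1 : Polynomial ℂ).coeff j = coeff j (phiTheory m s lam).kin := by
  simp [phiTheory, coeff_one, Polynomial.coeff_one]

end Truncation

end FieldDiffeo

end

/-! ### Equality of the amplitudes -/

theorem mainTheorem7 (d : ℕ) (m : ℝ) (hm : 0 ≤ m) (s : ℕ) (hs : 3 ≤ s) (lam : ℂ)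
    (a : ℕ → ℂ) (ha : a 0 = 1) (n : ℕ) (hn : 3 ≤ n)
    (p : Fin n → FieldDiffeo.Momentum d)
    (hconserved : ∑ i, p i = 0)
    (honshell : ∀ i, FieldDiffeo.offshell m (p i) = 0)
    (hgeneric : ∀ S : Finset (Fin n), 2 ≤ S.card → S.card + 2 ≤ n →
      FieldDiffeo.offshell m (∑ i ∈ S, p i) ≠ 0)
    (r : Fin n) :
    FieldDiffeo.treeSum
        ((FieldDiffeo.phiTheory m s lam).pullback (FieldDiffeo.diffeo a)) p r =
      FieldDiffeo.treeSum (FieldDiffeo.phiTheory m s lam) p r := by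
  open FieldDiffeo in
  obtain ⟨T, hT⟩ : ∃ T, T = Finset.univ.erase r := ⟨_, rfl⟩
  have hTcard : T.card = n - 1 := by simp [hT]
  have hTne : T.Nonempty := Finset.card_pos.mp (by omega)
  have hTinflow : offshell m (inflow p T) = 0 := by
    have h : inflow p T = -p r := by
      rw [eq_neg_iff_add_eq_zero, hT, inflow, Finset.sum_erase_add _ _ (Finset.mem_univ r),
        hconserved]
    rw [h, ← honshell r]
    simp [offshell, mdot]
  have hon : ∀ S : Finset (Fin n), S.card = 1 → offshell m (inflow p S) = 0 := by
    intro S hS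
    obtain ⟨i, rfl⟩ := Finset.card_eq_one.mp hS
    simpa [inflow] using honshell i
  have hoff : ∀ S, S ⊂ T → 2 ≤ S.card → offshell m (inflow p S) ≠ 0 := by
    intro S hS h2
    have := Finset.card_lt_card hS
    exact hgeneric S h2 (by omega)
  obtain ⟨L, hL⟩ : ∃ L, L = (phiTheory m s lam).pullback (diffeo a) := ⟨_, rfl⟩
  have hLprop : ∀ q : Momentum d, L.propagator q = Complex.I / offshell m q := by
    intro q
    rw [hL, propagator_pullback m s hs lam a ha]
  -- Potential coefficients are needed up to degree `S.card + 1 ≤ n + 1`, which the cutoff `n + 2`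
  -- keeps exact.
  obtain ⟨Φ, hΦ⟩ : ∃ Φ, Φ = PowerSeries.trunc (n + 2) (diffeo a) := ⟨_, rfl⟩
  have hΦ0 : Φ.coeff 0 = 0 := by simp [hΦ, PowerSeries.coeff_trunc, diffeo]
  have hΦ1 : Φ.coeff 1 = 1 := by
    have : (PowerSeries.coeff 1) (diffeo a) = 1 := by
      rw [diffeo, ← zero_add 1, PowerSeries.coeff_succ_X_mul]
      simp [ha]
    simp [hΦ, PowerSeries.coeff_trunc, this]
  have hΦ1' : (Polynomial.derivative Φ).coeff 0 = 1 := by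
    simp [Polynomial.coeff_derivative, hΦ1]
  have hcard : ∀ S : Finset (Fin n), S.card ≤ n := fun S => by
    simpa using Finset.card_le_univ S
  have hK : ∀ S : Finset (Fin n), ∀ j < S.card,
      (Polynomial.derivative Φ ^ 2).coeff j = PowerSeries.coeff j L.kin := by
    intro S j hj
    have := hcard S
    rw [hL, hΦ, coeff_derivative_trunc_sq a (by omega)]
  have hU : ∀ S : Finset (Fin n), ∀ j ≤ S.card + 1,
      ((phiPot m s lam).comp Φ).coeff j = PowerSeries.coeff j L.pot := by
    intro S j hj
    have := hcard S
    rw [hL, hΦ, coeff_phiPot_comp_trunc a (by omega)]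
  have hK' := coeff_one_phiTheory_kin m s lam
  have hU' := coeff_phiPot m s lam
  have hprop' := propagator_phiTheory m s hs lam (d := d)
  obtain ⟨ρ, hρ⟩ : ∃ ρ, ρ = genPoly (current L p) := ⟨_, rfl⟩
  obtain ⟨y, hy⟩ : ∃ y, y = Polynomial.aeval ρ Φ := ⟨_, rfl⟩
  obtain ⟨z, hz⟩ : ∃ z, z = genPoly (current (phiTheory m s lam) p) := ⟨_, rfl⟩
  have hρ0 : ρ.coeff 0 = 0 := by
    rw [← expo_empty, hρ, coeff_genPoly, current_empty]
  have hz0 : z.coeff 0 = 0 := by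
    rw [← expo_empty, hz, coeff_genPoly, current_empty]
  have hy0 : y.coeff 0 = 0 := by rw [hy, coeff_zero_aeval hρ0, hΦ0]
  have hs1 : 2 ≤ s - 1 := by omega
  have hcov : ∀ S, (∀ S', S' ⊂ S → (fieldEq p 1 (phiPot m s lam) y).coeff (expo S') = 0) →
      (fieldEq p (Polynomial.derivative Φ ^ 2) ((phiPot m s lam).comp Φ) ρ).coeff (expo S) =
        (fieldEq p 1 (phiPot m s lam) y).coeff (expo S) := by
    intro S hS
    rw [fieldEq_comp, ← hy, coeff_mul_of_forall_ssubset hS, coeff_zero_aeval hρ0, hΦ1', mul_one]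
  -- Strong induction: `hcov` strips the factor `Φ'(ρ)` at `S` only once the equation holds strictly
  -- below `S`.
  have hyEq : ∀ S, S ⊂ T → (fieldEq p 1 (phiPot m s lam) y).coeff (expo S) = 0 := by
    intro S
    induction S using Finset.strongInduction with
    | H S ih =>
      intro hST
      rcases S.eq_empty_or_nonempty with rfl | hS
      · rw [coeff_fieldEq_phiPot, coeff_pow_congr (g := 0) hy0 (by simp) (by simp) hs1,
          zero_pow (by omega), expo_empty, hy0]
        simp
      · rw [← hcov S fun S' hS' => ih S' hS' (hS'.trans hST), hρ]
        exact coeff_fieldEq_current_eq_zero L p hLprop hS (hK S) (hU S) (hon S) (hoff S hST)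
  have hyz : ∀ S, S ⊂ T → y.coeff (expo S) = z.coeff (expo S) := by
    intro S
    induction S using Finset.strongInduction with
    | H S ih =>
      intro hST
      rcases S.eq_empty_or_nonempty with rfl | hS
      · rw [expo_empty, hy0, hz0]
      · by_cases h1 : S.card = 1
        · obtain ⟨i, rfl⟩ := Finset.card_eq_one.mp h1
          rw [hy, coeff_singleton_aeval hρ0 hΦ0, hΦ1, hρ, hz, coeff_genPoly, coeff_genPoly,
            current_singleton, current_singleton, mul_one]
        · have h2 : 2 ≤ S.card := by
            have := hS.card_pos
            omega
          have hy1 := hyEq S hST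
          have hz1 : (fieldEq p 1 (phiPot m s lam) z).coeff (expo S) = 0 := by
            rw [hz]
            exact coeff_fieldEq_current_eq_zero _ p hprop' hS (fun j _ => hK' j)
              (fun j _ => hU' j) (hon S) (hoff S hST)
          rw [coeff_fieldEq_phiPot] at hy1 hz1
          rw [coeff_pow_congr hy0 hz0 (fun S' hS' => ih S' hS' (hS'.trans hST)) hs1] at hy1
          -- The equation determines the coefficient at `S` from smaller sets, because `x_{p_S} ≠
          -- 0`.
          exact mul_left_cancel₀ (hoff S hST h2) (by linear_combination hy1 - hz1)
  -- The coefficients of `y` and `z` at `T` may differ, but they enter only multiplied by `x_{p_T} =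
  -- 0`.
  have htop : (fieldEq p (Polynomial.derivative Φ ^ 2) ((phiPot m s lam).comp Φ) ρ).coeff
      (expo T) = (fieldEq p 1 (phiPot m s lam) z).coeff (expo T) := by
    rw [hcov T hyEq, coeff_fieldEq_phiPot, coeff_fieldEq_phiPot, hTinflow,
      coeff_pow_congr hy0 hz0 hyz hs1]
    ring
  have hT2 : 2 ≤ T.card := by omega
  rw [treeSum, treeSum, ← hT, ← hL, sum_amplitude _ p hT2, sum_amplitude _ p hT2]
  have e1 := coeff_fieldEq_current L p hLprop hTne (hK T) (hU T)
  have e2 := coeff_fieldEq_current (phiTheory m s lam) p hprop' hTne (fun j _ => hK' j)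
    (fun j _ => hU' j)
  rw [hTinflow] at e1 e2
  rw [← hρ, htop, hz] at e1
  linear_combination e2 - e1
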